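/- Let $m,r,d_1,\dots,d_m\ge 1$ be integers, $D=\sum_{i=1}^m d_i$, and write $\mathcal O_{d,r}=\{O\in\mathbb R^{d\times r}: O^TO=I_r\}$. For $X\in\mathbb R^{D\times D}$ let $X_{ij}\in\mathbb R^{d_i\times d_j}$ be its $(i,j)$ block, and for $Y\in\mathbb R^{D\times r}$ let $[Y]_i\in\mathbb R^{d_i\times r}$ be its $i$-th block of rows; $\|\cdot\|$ is the operator norm and $\|\cdot\|_F$ the Frobenius norm. Assume the MAXBET model: $\Theta_i\in\mathcal O_{d_i,r}$ for all $i$, $W\in\mathbb R^{D\times D}$ satisfies $W_{ij}=W_{ji}^T$ for all $i,j$, and $S_{ij}=\Theta_i\Theta_j^T+W_{ij}$ for all $1\le i,j\le m$, i.e. $S=\Theta\Theta^T+W$, where $\Theta\in\mathbb R^{D\times r}$ is obtained by stacking $\Theta_1,\dots,\Theta_m$. Consider the problems (OTSM) maximize $\sum_{1\le i,j\le m}\operatorname{tr}(O_i^TS_{ij}O_j)$ over $O_i\in\mathcal O_{d_i,r}$, $i=1,\dots,m$; (rank-$r$) maximize $\operatorname{tr}(SU)$ over $U=U^T\in\mathbb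 R^{D\times D}$ with $U\succcurlyeq 0$, $\operatorname{rank}(U)=r$, and $U_{ii}\preccurlyeq I$, $\operatorname{tr}(U_{ii})=r$ for $i=1,\dots,m$; (SDP) the rank-$r$ problem without the constraint $\operatorname{rank}(U)=r$. **Theorem 3.1.** Put $A=\max_{1\le i\le m}\|[W\Theta]_i\|_F+4\|W\|^2\sqrt{r/m}$. Suppose that $m>\|W\|(4\sqrt r+1)+1$ and $$m> 4m\,\frac{2A}{m-\|W\|(4\sqrt r+1)-1}+2A+8\|W\|\sqrt{\frac rm}+2\|W\|.$$ Then the relaxation is tight: (SDP) has a solution, and every solution $\hat U$ of (SDP) also solves the rank-$r$ problem and has the form $\hat U=OO^T$, where $O\in\mathbb R^{D\times r}$ is obtained by stacking some solution $(O_1,\dots,O_m)$ of (OTSM). -/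

import Mathlib

namespace OTSM

open scoped Matrix

/-- Row indices of a matrix with `D = d₁ + ⋯ + d_m` rows, split into `m` blocks;
`⟨i, a⟩` is the `a`-th row of the `i`-th block. -/
abbrev Idx {m : ℕ} (d : Fin m → ℕ) : Type := Σ i : Fin m, Fin (d i)

/-- The `(i, j)` block `X_{ij}` (of size `d_i × d_j`) of a `D × D` matrix. -/
def block {m : ℕ} {d : Fin m → ℕ} (X : Matrix (Idx d) (Idx d) ℝ) (i j : Fin m) :
    Matrix (Fin (d i)) (Fin (d j)) ℝ :=
  Matrix.of fun a b => X ⟨i, a⟩ ⟨j, b⟩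

/-- The `i`-th block `Y_i` (of size `d_i × r`) of a `D × r` matrix. -/
def rowBlock {m r : ℕ} {d : Fin m → ℕ} (Y : Matrix (Idx d) (Fin r) ℝ) (i : Fin m) :
    Matrix (Fin (d i)) (Fin r) ℝ :=
  Matrix.of fun a k => Y ⟨i, a⟩ k

/-- The `D × r` matrix obtained by stacking `O₁, …, O_m` vertically. -/
def stack {m r : ℕ} {d : Fin m → ℕ} (O : (i : Fin m) → Matrix (Fin (d i)) (Fin r) ℝ) :
    Matrix (Idx d) (Fin r) ℝ :=
  Matrix.of fun p k => O p.1 p.2 k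

/-- The Stiefel manifold `𝒪_{d,r}` of semi-orthogonal `d × r` matrices. -/
def stiefel (d r : ℕ) : Set (Matrix (Fin d) (Fin r) ℝ) :=
  {O | Oᵀ * O = 1}

/-- The operator norm of a square real matrix, as a map between Euclidean spaces. -/
noncomputable def opNorm {n : Type*} [Fintype n] [DecidableEq n] (X : Matrix n n ℝ) : ℝ :=
  ‖Matrix.toEuclideanCLM (𝕜 := ℝ) X‖

/-- The Frobenius norm of a real matrix. -/
noncomputable def frobNorm {p q : Type*} [Fintype p] [Fintype q] (X : Matrix p q ℝ) : ℝ :=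
  √(∑ a, ∑ b, X a b ^ 2)

/-- The MAXBET model: `S_{ij} = Θ_i Θ_jᵀ + W_{ij}` with `Θ_i` semi-orthogonal and
`W_{ij} = W_{ji}ᵀ`, for all `i, j` (the diagonal blocks included). -/
structure IsMAXBET {m r : ℕ} {d : Fin m → ℕ}
    (Θ : (i : Fin m) → Matrix (Fin (d i)) (Fin r) ℝ) (W S : Matrix (Idx d) (Idx d) ℝ) :
    Prop where
  semiorth : ∀ i, Θ i ∈ stiefel (d i) r
  noise_symm : ∀ i j, block W i j = (block W j i)ᵀ
  model : ∀ i j, block S i j = Θ i * (Θ j)ᵀ + block W i j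

/-- `O = (O₁, …, O_m)` is a (global) solution of the orthogonal trace-sum maximization problem. -/
def IsOTSMSolution {m r : ℕ} {d : Fin m → ℕ} (S : Matrix (Idx d) (Idx d) ℝ)
    (O : (i : Fin m) → Matrix (Fin (d i)) (Fin r) ℝ) : Prop :=
  (∀ i, O i ∈ stiefel (d i) r) ∧
    IsMaxOn (fun Q : (i : Fin m) → Matrix (Fin (d i)) (Fin r) ℝ =>
        ∑ i, ∑ j, ((Q i)ᵀ * block S i j * Q j).trace)
      {Q | ∀ i, Q i ∈ stiefel (d i) r} O

/-- The constraint set of the semidefinite relaxation: `U = Uᵀ`, `U ≽ 0`, and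
`U_{ii} ≼ I`, `tr U_{ii} = r` for every `i`. -/
def sdpFeasible {m : ℕ} (d : Fin m → ℕ) (r : ℕ) : Set (Matrix (Idx d) (Idx d) ℝ) :=
  {U | U.IsSymm ∧ U.PosSemidef ∧
    ∀ i, (1 - block U i i).PosSemidef ∧ (block U i i).trace = r}

/-- The constraint set of the rank-`r` problem: that of the relaxation and `rank U = r`. -/
def rankFeasible {m : ℕ} (d : Fin m → ℕ) (r : ℕ) : Set (Matrix (Idx d) (Idx d) ℝ) :=
  {U | U ∈ sdpFeasible d r ∧ U.rank = r}

/-- `U` solves the semidefinite relaxation: it maximizes `tr(S U)`, which is `⟨S, U⟩` as `U` is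
symmetric, over the constraint set of the relaxation. -/
def IsSDPSolution {m : ℕ} {d : Fin m → ℕ} (r : ℕ) (S U : Matrix (Idx d) (Idx d) ℝ) : Prop :=
  U ∈ sdpFeasible d r ∧
    IsMaxOn (fun U' : Matrix (Idx d) (Idx d) ℝ => (S * U').trace) (sdpFeasible d r) U

/-- `U` solves the rank-`r` problem: it maximizes `tr(S U)` over the rank-`r` constraint set. -/
def IsRankSolution {m : ℕ} {d : Fin m → ℕ} (r : ℕ) (S U : Matrix (Idx d) (Idx d) ℝ) : Prop :=
  U ∈ rankFeasible d r ∧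
    IsMaxOn (fun U' : Matrix (Idx d) (Idx d) ℝ => (S * U').trace) (rankFeasible d r) U

/-- `max_i ‖[W Θ]_i‖_F + 4 ‖W‖² √(r/m)`. -/
noncomputable def noiseLevel {m r : ℕ} {d : Fin m → ℕ}
    (Θ : (i : Fin m) → Matrix (Fin (d i)) (Fin r) ℝ) (W : Matrix (Idx d) (Idx d) ℝ) : ℝ :=
  (⨆ i : Fin m, frobNorm (rowBlock (W * stack Θ) i)) +
    4 * opNorm W ^ 2 * √((r : ℝ) / (m : ℝ))

end OTSM

/-! The argument is Lagrangian duality with a certificate built from a maximizer of (OTSM). Rotate a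
maximizer `O` on the right so that the stacked `P = Θᵀ O` is positive semidefinite; this changes
neither `O Oᵀ` nor the objective. First-order optimality of each block gives `[S O]_i = O_i Λ_i`
with `Λ_i` symmetric (`IsOTSMSolution.multiplier`). If every `Λ_i ≽ z`, then `L = z I + blockdiag
(O_i (Λ_i - z) O_iᵀ) - S` annihilates `O`, and weak duality bounds `tr(S U)` by `∑ tr Λ_i`, the
value at `O Oᵀ`. If moreover the form of `S` is at most `z - κ` on the complement of the range of
`O`, with `κ > 0`, equality forces the range of `U` into that of `O`, hence `U = O Oᵀ`
(`trace_mul_le_and_eq`).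

Small noise supplies this gap. Comparing the values at `O` and `Θ` bounds `‖O - Θ‖_F`
(`frobNorm_sub_le`); replacing the single block `O_i` by `Θ_i` improves this to a uniform blockwise
bound `e` (`IsMAXBET.mul_frobNorm_sub_le`). Since `[S O]_i = Θ_i P + [W O]_i` with `P` close to `m
I`, each `Λ_i` is of order `m` (`le_frobInner_multiplier`), while orthogonally to `O` the signal
contributes only `m e²` and the noise `‖W‖` (`IsMAXBET.frobInner_le_of_orthogonal`). -/

namespace OTSM

open scoped Matrix

/-! ### Frobenius inner product and norm inequalities. -/

section Frobenius

variable {p q n k : Type*} [Fintype p] [Fintype q] [Fintype n] [Fintype k]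

/-- The Frobenius inner product `tr(Aᵀ B)`. -/
def frobInner (A B : Matrix p q ℝ) : ℝ := (Aᵀ * B).trace

theorem frobInner_eq_sum (A B : Matrix p q ℝ) : frobInner A B = ∑ a, ∑ b, A a b * B a b := by
  rw [Finset.sum_comm]
  rfl

theorem frobInner_comm (A B : Matrix p q ℝ) : frobInner A B = frobInner B A := by
  simp only [frobInner_eq_sum, mul_comm]

theorem frobInner_add_left (A B C : Matrix p q ℝ) :
    frobInner (A + B) C = frobInner A C + frobInner B C := by
  simp [frobInner, Matrix.add_mul]

theorem frobInner_add_right (A B C : Matrix p q ℝ) :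
    frobInner A (B + C) = frobInner A B + frobInner A C := by
  simp [frobInner, Matrix.mul_add]

theorem frobInner_sub_left (A B C : Matrix p q ℝ) :
    frobInner (A - B) C = frobInner A C - frobInner B C := by
  simp [frobInner, Matrix.sub_mul]

theorem frobInner_sub_right (A B C : Matrix p q ℝ) :
    frobInner A (B - C) = frobInner A B - frobInner A C := by
  simp [frobInner, Matrix.mul_sub]

theorem frobInner_smul_left (c : ℝ) (A B : Matrix p q ℝ) :
    frobInner (c • A) B = c * frobInner A B := by
  simp [frobInner]

theorem frobInner_smul_right (c : ℝ) (A B : Matrix p q ℝ) :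
    frobInner A (c • B) = c * frobInner A B := by
  simp [frobInner]

theorem frobInner_mul_left (A : Matrix p n ℝ) (B : Matrix n q ℝ) (C : Matrix p q ℝ) :
    frobInner (A * B) C = frobInner B (Aᵀ * C) := by
  simp [frobInner, Matrix.mul_assoc]

theorem frobInner_mul_right (A : Matrix p n ℝ) (B : Matrix n q ℝ) (C : Matrix p q ℝ) :
    frobInner C (A * B) = frobInner (Aᵀ * C) B := by
  rw [frobInner_comm, frobInner_mul_left, frobInner_comm]

theorem frobInner_transpose (A B : Matrix p q ℝ) : frobInner Aᵀ Bᵀ = frobInner A B := by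
  simp only [frobInner_eq_sum, Matrix.transpose_apply]
  exact Finset.sum_comm

theorem frobInner_mul_right' (A : Matrix p n ℝ) (B : Matrix n q ℝ) (C : Matrix p q ℝ) :
    frobInner C (A * B) = frobInner (C * Bᵀ) A := by
  rw [← frobInner_transpose, Matrix.transpose_mul, frobInner_mul_right, ← frobInner_transpose]
  simp

theorem frobNorm_eq_norm (A : Matrix p q ℝ) :
    frobNorm A = ‖(WithLp.toLp 2 fun x : p × q => A x.1 x.2 : EuclideanSpace ℝ (p × q))‖ := by
  simp [frobNorm, EuclideanSpace.norm_eq, Fintype.sum_prod_type]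

theorem frobNorm_nonneg (A : Matrix p q ℝ) : 0 ≤ frobNorm A := Real.sqrt_nonneg _

theorem frobInner_self (A : Matrix p q ℝ) : frobInner A A = frobNorm A ^ 2 := by
  rw [frobNorm, Real.sq_sqrt (by positivity), frobInner_eq_sum]
  simp only [sq]

theorem frobInner_le (A B : Matrix p q ℝ) : frobInner A B ≤ frobNorm A * frobNorm B := by
  have h := real_inner_le_norm
    (WithLp.toLp 2 fun x : p × q => A x.1 x.2 : EuclideanSpace ℝ (p × q))
    (WithLp.toLp 2 fun x : p × q => B x.1 x.2)
  rw [← frobNorm_eq_norm, ← frobNorm_eq_norm] at h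
  refine le_trans (le_of_eq ?_) h
  simp [frobInner_eq_sum, PiLp.inner_apply, Fintype.sum_prod_type, mul_comm]

theorem frobNorm_add_le (A B : Matrix p q ℝ) : frobNorm (A + B) ≤ frobNorm A + frobNorm B := by
  simp only [frobNorm_eq_norm]
  exact norm_add_le (WithLp.toLp 2 fun x : p × q => A x.1 x.2 : EuclideanSpace ℝ (p × q))
    (WithLp.toLp 2 fun x : p × q => B x.1 x.2)

theorem frobNorm_neg (A : Matrix p q ℝ) : frobNorm (-A) = frobNorm A := by
  simp [frobNorm]

theorem neg_le_frobInner (A B : Matrix p q ℝ) : -(frobNorm A * frobNorm B) ≤ frobInner A B := by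
  have h := frobInner_le (-A) B
  rw [frobNorm_neg] at h
  have : frobInner (-A) B = - frobInner A B := by simp [frobInner]
  linarith

theorem frobNorm_transpose (A : Matrix p q ℝ) : frobNorm Aᵀ = frobNorm A := by
  rw [frobNorm, frobNorm, Finset.sum_comm]
  rfl

theorem frobNorm_eq_zero {A : Matrix p q ℝ} (h : frobNorm A = 0) : A = 0 := by
  rw [frobNorm_eq_norm, norm_eq_zero] at h
  ext a b
  exact congrFun (congrArg WithLp.ofLp h) (a, b)

theorem frobNorm_mul_le (A : Matrix p n ℝ) (B : Matrix n q ℝ) :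
    frobNorm (A * B) ≤ frobNorm A * frobNorm B := by
  rw [frobNorm, frobNorm, frobNorm, ← Real.sqrt_mul (by positivity)]
  apply Real.sqrt_le_sqrt
  rw [Finset.sum_comm (f := fun a b => B a b ^ 2), Finset.sum_mul_sum]
  refine Finset.sum_le_sum fun a _ => Finset.sum_le_sum fun b _ => ?_
  exact Finset.sum_mul_sq_le_sq_mul_sq _ _ _

theorem opNorm_nonneg [DecidableEq p] (W : Matrix p p ℝ) : 0 ≤ opNorm W := norm_nonneg _

theorem frobNorm_mul_le_opNorm [DecidableEq p] (W : Matrix p p ℝ) (X : Matrix p q ℝ) :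
    frobNorm (W * X) ≤ opNorm W * frobNorm X := by
  have h0 := opNorm_nonneg W
  rw [frobNorm, Real.sqrt_le_left (by positivity [frobNorm_nonneg X]), mul_pow, frobNorm,
    Real.sq_sqrt (by positivity), Finset.sum_comm, Finset.sum_comm (f := fun a b => X a b ^ 2),
    Finset.mul_sum]
  refine Finset.sum_le_sum fun b _ => ?_
  have h := (Matrix.toEuclideanCLM (𝕜 := ℝ) W).le_opNorm (WithLp.toLp 2 fun a => X a b)
  have h2 := pow_le_pow_left₀ (norm_nonneg _) h 2
  rw [mul_pow, EuclideanSpace.norm_sq_eq, EuclideanSpace.norm_sq_eq] at h2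
  simpa [Matrix.toEuclideanCLM_toLp, Matrix.mulVec, dotProduct, Matrix.mul_apply, opNorm] using h2

theorem frobNorm_sq_of_gram [DecidableEq n] {A : Matrix p n ℝ} {c : ℝ} (hA : Aᵀ * A = c • 1)
    (X : Matrix n q ℝ) : frobNorm (A * X) ^ 2 = c * frobNorm X ^ 2 := by
  rw [← frobInner_self, frobInner_mul_left, ← Matrix.mul_assoc, hA, ← frobInner_self]
  simp [frobInner_smul_right]

theorem frobNorm_mul_of_gram [DecidableEq n] {A : Matrix p n ℝ} {c : ℝ} (hc : 0 ≤ c)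
    (hA : Aᵀ * A = c • 1) (X : Matrix n q ℝ) : frobNorm (A * X) = √c * frobNorm X := by
  rw [← Real.sqrt_sq (frobNorm_nonneg (A * X)), frobNorm_sq_of_gram hA, Real.sqrt_mul hc,
    Real.sqrt_sq (frobNorm_nonneg X)]

/-- By duality: `‖AᵀY‖² = ⟨A AᵀY, Y⟩ ≤ √c ‖AᵀY‖ ‖Y‖`, then cancel one factor. -/
theorem frobNorm_transpose_mul_of_gram [DecidableEq n] {A : Matrix p n ℝ} {c : ℝ} (hc : 0 ≤ c)
    (hA : Aᵀ * A = c • 1) (Y : Matrix p q ℝ) : frobNorm (Aᵀ * Y) ≤ √c * frobNorm Y := by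
  have h1 : frobNorm (Aᵀ * Y) ^ 2 ≤ √c * frobNorm (Aᵀ * Y) * frobNorm Y := by
    rw [← frobNorm_mul_of_gram hc hA, ← frobInner_self, ← frobInner_mul_left]
    exact frobInner_le _ _
  rcases (frobNorm_nonneg (Aᵀ * Y)).eq_or_lt with h | h
  · rw [← h]; exact mul_nonneg (Real.sqrt_nonneg _) (frobNorm_nonneg _)
  · nlinarith

theorem frobNorm_one (r : ℕ) : frobNorm (1 : Matrix (Fin r) (Fin r) ℝ) = √r := by
  rw [← Real.sqrt_sq (frobNorm_nonneg _), ← frobInner_self, frobInner]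
  simp

theorem frobInner_add_mul_add {S : Matrix p p ℝ} (hS : Sᵀ = S)
    (V E : Matrix p q ℝ) :
    frobInner (V + E) (S * (V + E)) =
      frobInner V (S * V) + 2 * frobInner E (S * V) + frobInner E (S * E) := by
  have h : frobInner V (S * E) = frobInner E (S * V) := by
    rw [frobInner_mul_right, hS, frobInner_comm]
  rw [Matrix.mul_add, frobInner_add_left, frobInner_add_right, frobInner_add_right, h]
  ring

end Frobenius

/-! ### Plane rotations, reflections and first-order conditions on the orthogonal group. -/

section Rotation

/-- The left side vanishes at `t = 0`, so `0` is a maximum, and its derivative there is `a`. This is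
the shape of a quadratic objective along a plane rotation. -/
theorem eq_zero_of_trig_le {a b c d e : ℝ}
    (h : ∀ t : ℝ, Real.sin t * a + (1 - Real.cos t) * b + Real.sin t ^ 2 * c +
      Real.sin t * (1 - Real.cos t) * d + (1 - Real.cos t) ^ 2 * e ≤ 0) : a = 0 := by
  set f : ℝ → ℝ := fun t => Real.sin t * a + (1 - Real.cos t) * b + Real.sin t ^ 2 * c +
      Real.sin t * (1 - Real.cos t) * d + (1 - Real.cos t) ^ 2 * e with hf
  have hs := Real.hasDerivAt_sin 0
  have hc := (Real.hasDerivAt_cos 0).const_sub 1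
  have h1 : HasDerivAt f _ 0 :=
    ((((hs.mul_const a).add (hc.mul_const b)).add ((hs.pow 2).mul_const c)).add
      ((hs.mul hc).mul_const d)).add ((hc.pow 2).mul_const e)
  have hmax : IsLocalMax f 0 := Filter.Eventually.of_forall fun t => by
    have : f 0 = 0 := by simp [hf]
    rw [this]
    exact h t
  have := hmax.hasDerivAt_eq_zero h1
  simpa using this

variable {n : Type*} [DecidableEq n]

/-- The infinitesimal rotation in the plane of the coordinates `a` and `b`. -/
def planeGen (a b : n) : Matrix n n ℝ := Matrix.single a b 1 - Matrix.single b a 1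

theorem planeGen_transpose (a b : n) : (planeGen a b)ᵀ = -planeGen a b := by
  simp [planeGen]

variable [Fintype n]

theorem planeGen_cube {a b : n} (hab : a ≠ b) :
    planeGen a b * planeGen a b * planeGen a b = -planeGen a b := by
  simp [planeGen, Matrix.mul_sub, Matrix.sub_mul, Matrix.single_mul_single_of_ne, hab, hab.symm]
  abel

/-- The rotation by the angle `t` in the plane of the coordinates `a` and `b`. -/
noncomputable def planeRot (a b : n) (t : ℝ) : Matrix n n ℝ :=
  1 + Real.sin t • planeGen a b + (1 - Real.cos t) • (planeGen a b * planeGen a b)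

/-- Rodrigues' formula: for skew `K` with `K³ = -K` the product is `1` plus a multiple of `K²` that
vanishes by `sin² + cos² = 1`. -/
theorem planeRot_orthogonal {a b : n} (hab : a ≠ b) (t : ℝ) :
    (planeRot a b t)ᵀ * planeRot a b t = 1 := by
  have h3 := planeGen_cube hab
  have hT := planeGen_transpose a b
  unfold planeRot
  generalize planeGen a b = K at h3 hT ⊢
  have h3' : K * (K * K) = -K := by rw [← Matrix.mul_assoc, h3]
  have h4 : K * K * (K * K) = -(K * K) := by rw [← Matrix.mul_assoc, h3, Matrix.neg_mul]
  simp only [Matrix.transpose_add, Matrix.transpose_smul, Matrix.transpose_mul, hT,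
    Matrix.transpose_one, Matrix.add_mul, Matrix.mul_add, Matrix.smul_mul, Matrix.mul_smul,
    Matrix.neg_mul, Matrix.mul_neg, neg_neg, h3, h3', h4, Matrix.one_mul, Matrix.mul_one]
  have hsc := Real.sin_sq_add_cos_sq t
  have : (1 - Real.cos t) + (1 - Real.cos t) - Real.sin t * Real.sin t
      - (1 - Real.cos t) * (1 - Real.cos t) = 0 := by linear_combination -hsc
  have key := congrArg (fun c : ℝ => c • (K * K)) this
  simp only [zero_smul] at key
  rw [← sub_eq_zero, ← key]
  module

/-- The plane generators span the skew matrices, so `N` has no skew part. -/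
theorem isSymm_of_frobInner_planeGen {N : Matrix n n ℝ}
    (h : ∀ a b, a ≠ b → frobInner (planeGen a b) N = 0) : Nᵀ = N := by
  ext a b
  rcases eq_or_ne a b with rfl | hab
  · rfl
  · have := h a b hab
    simp [frobInner, planeGen, Matrix.sub_mul, Matrix.trace_single_mul] at this
    simp only [Matrix.transpose_apply]
    linarith

theorem stiefel_self_mul_transpose {r : ℕ} {Q : Matrix (Fin r) (Fin r) ℝ}
    (hQ : Q ∈ stiefel r r) : Q * Qᵀ = 1 := mul_eq_one_comm.mp hQ

theorem isCompact_stiefel (d r : ℕ) : IsCompact (stiefel d r) := by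
  have hsub : stiefel d r ⊆ Set.pi Set.univ fun _ => Set.pi Set.univ fun _ => Set.Icc (-1) 1 := by
    intro O hO a _ b _
    have h : (Oᵀ * O) b b = 1 := by rw [show Oᵀ * O = 1 from hO, Matrix.one_apply_eq]
    rw [Matrix.mul_apply] at h
    have h2 : O a b * O a b ≤ ∑ x, Oᵀ b x * O x b :=
      Finset.single_le_sum (f := fun x => Oᵀ b x * O x b)
        (fun x _ => mul_self_nonneg (O x b)) (Finset.mem_univ a)
    exact abs_le.mp (abs_le_one_iff_mul_self_le_one.mpr (h2.trans h.le))
  refine IsCompact.of_isClosed_subset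
    (isCompact_univ_pi fun _ => isCompact_univ_pi fun _ => isCompact_Icc) ?_ hsub
  exact isClosed_eq (by fun_prop) continuous_const

/-- If `Q = 1` maximizes `tr(P Q)` over the orthogonal group, then `P` is positive semidefinite. -/
theorem posSemidef_of_trace_mul_le {r : ℕ} {P : Matrix (Fin r) (Fin r) ℝ}
    (h : ∀ Q ∈ stiefel r r, (P * Q).trace ≤ P.trace) : P.PosSemidef := by
  have hsymm : Pᵀ = P := by
    rw [eq_comm, ← Matrix.transpose_transpose P]
    apply isSymm_of_frobInner_planeGen
    intro a b hab
    apply eq_zero_of_trig_le (b := (P * (planeGen a b * planeGen a b)).trace) (c := 0) (d := 0)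
      (e := 0)
    intro t
    have := h _ (planeRot_orthogonal hab t)
    simp only [planeRot, Matrix.mul_add, Matrix.mul_smul, Matrix.trace_add, Matrix.trace_smul,
      smul_eq_mul, Matrix.mul_one] at this
    have h2 : frobInner (planeGen a b) Pᵀ = (P * planeGen a b).trace := by
      rw [frobInner_comm, frobInner, Matrix.transpose_transpose]
    rw [h2]
    linarith
  refine Matrix.PosSemidef.of_dotProduct_mulVec_nonneg hsymm fun x => ?_
  simp only [star_trivial]
  rcases eq_or_ne (x ⬝ᵥ x) 0 with h0 | h0
  · rw [dotProduct_self_eq_zero.mp h0]; simp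
  have hpos : 0 < x ⬝ᵥ x := lt_of_le_of_ne (dotProduct_star_self_nonneg x) h0.symm
  -- Testing against the Householder reflection in `x` isolates the quadratic form of `P` at `x`.
  have hQ : (1 - (2 / (x ⬝ᵥ x)) • Matrix.vecMulVec x x) ∈ stiefel r r := by
    change _ᵀ * _ = _
    simp only [Matrix.transpose_sub, Matrix.transpose_one, Matrix.transpose_smul,
      Matrix.transpose_vecMulVec, Matrix.sub_mul, Matrix.mul_sub, Matrix.one_mul, Matrix.mul_one,
      Matrix.smul_mul, Matrix.mul_smul, Matrix.vecMulVec_mul_vecMulVec]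
    ext i j
    simp [Matrix.vecMulVec_apply]
    field_simp
    ring
  have := h _ hQ
  rw [Matrix.mul_sub, Matrix.mul_one, Matrix.trace_sub, Matrix.mul_smul, Matrix.trace_smul,
    Matrix.mul_vecMulVec, Matrix.trace_vecMulVec, smul_eq_mul] at this
  have h3 : 0 ≤ 2 / (x ⬝ᵥ x) * (P.mulVec x ⬝ᵥ x) := by linarith
  rw [dotProduct_comm]
  exact nonneg_of_mul_nonneg_right h3 (by positivity)

end Rotation

/-! ### Calculus of row blocks and stacked matrices. -/

section Blocks

variable {m r k : ℕ} {d : Fin m → ℕ}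

theorem rowBlock_stack (O : (i : Fin m) → Matrix (Fin (d i)) (Fin r) ℝ) (i : Fin m) :
    rowBlock (stack O) i = O i := rfl

theorem rowBlock_add (X Y : Matrix (Idx d) (Fin r) ℝ) (i : Fin m) :
    rowBlock (X + Y) i = rowBlock X i + rowBlock Y i := rfl

theorem rowBlock_sub (X Y : Matrix (Idx d) (Fin r) ℝ) (i : Fin m) :
    rowBlock (X - Y) i = rowBlock X i - rowBlock Y i := rfl

theorem rowBlock_mul (X : Matrix (Idx d) (Fin r) ℝ) (Y : Matrix (Fin r) (Fin k) ℝ) (i : Fin m) :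
    rowBlock (X * Y) i = rowBlock X i * Y := rfl

theorem frobInner_eq_sum_rowBlock (X Y : Matrix (Idx d) (Fin r) ℝ) :
    frobInner X Y = ∑ i, frobInner (rowBlock X i) (rowBlock Y i) := by
  simp only [frobInner_eq_sum, Fintype.sum_sigma]
  rfl

theorem frobNorm_sq_eq_sum_rowBlock (X : Matrix (Idx d) (Fin r) ℝ) :
    frobNorm X ^ 2 = ∑ i, frobNorm (rowBlock X i) ^ 2 := by
  simp only [← frobInner_self, frobInner_eq_sum_rowBlock X]

theorem frobNorm_rowBlock_le (X : Matrix (Idx d) (Fin r) ℝ) (i : Fin m) :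
    frobNorm (rowBlock X i) ≤ frobNorm X := by
  refine le_of_sq_le_sq ?_ (frobNorm_nonneg _)
  rw [frobNorm_sq_eq_sum_rowBlock X]
  exact Finset.single_le_sum (f := fun i => frobNorm (rowBlock X i) ^ 2)
    (fun _ _ => sq_nonneg _) (Finset.mem_univ i)

theorem transpose_stack_mul_stack (X Y : (i : Fin m) → Matrix (Fin (d i)) (Fin r) ℝ) :
    (stack X)ᵀ * stack Y = ∑ i, (X i)ᵀ * Y i := by
  ext a b
  simp only [Matrix.mul_apply, Matrix.sum_apply, Fintype.sum_sigma]
  rfl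

theorem gram_stack {O : (i : Fin m) → Matrix (Fin (d i)) (Fin r) ℝ}
    (hO : ∀ i, O i ∈ stiefel (d i) r) : (stack O)ᵀ * stack O = (m : ℝ) • 1 := by
  rw [transpose_stack_mul_stack, Finset.sum_congr rfl fun i _ => hO i]
  simp [← Nat.cast_smul_eq_nsmul ℝ]

theorem rowBlock_mul_stack (S : Matrix (Idx d) (Idx d) ℝ)
    (O : (i : Fin m) → Matrix (Fin (d i)) (Fin r) ℝ) (i : Fin m) :
    rowBlock (S * stack O) i = ∑ j, block S i j * O j := by
  ext a b
  simp only [rowBlock, Matrix.of_apply, Matrix.mul_apply, Matrix.sum_apply, Fintype.sum_sigma]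
  rfl

theorem sum_trace_eq_frobInner (S : Matrix (Idx d) (Idx d) ℝ)
    (O : (i : Fin m) → Matrix (Fin (d i)) (Fin r) ℝ) :
    ∑ i, ∑ j, ((O i)ᵀ * block S i j * O j).trace = frobInner (stack O) (S * stack O) := by
  rw [frobInner_eq_sum_rowBlock]
  refine Finset.sum_congr rfl fun i _ => ?_
  rw [rowBlock_stack, rowBlock_mul_stack, frobInner, Matrix.mul_sum, Matrix.trace_sum]
  simp only [Matrix.mul_assoc]

/-- The `D × r` matrix whose only nonzero row block is the `i`-th one, equal to `X`. -/
def singleBlock (i : Fin m) (X : Matrix (Fin (d i)) (Fin r) ℝ) : Matrix (Idx d) (Fin r) ℝ :=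
  stack (Pi.single i X)

theorem frobInner_singleBlock (i : Fin m) (X : Matrix (Fin (d i)) (Fin r) ℝ)
    (Y : Matrix (Idx d) (Fin r) ℝ) :
    frobInner (singleBlock i X) Y = frobInner X (rowBlock Y i) := by
  rw [frobInner_eq_sum_rowBlock, Finset.sum_eq_single i]
  · simp [singleBlock, rowBlock_stack]
  · intro j _ hj
    simp [singleBlock, rowBlock_stack, hj, frobInner]
  · simp

theorem frobNorm_singleBlock (i : Fin m) (X : Matrix (Fin (d i)) (Fin r) ℝ) :
    frobNorm (singleBlock i X) = frobNorm X := by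
  rw [← Real.sqrt_sq (frobNorm_nonneg (singleBlock i X)), ← frobInner_self, frobInner_singleBlock]
  simp [singleBlock, rowBlock_stack, frobInner_self, frobNorm_nonneg]

theorem stack_update (O : (i : Fin m) → Matrix (Fin (d i)) (Fin r) ℝ) (i : Fin m)
    (X : Matrix (Fin (d i)) (Fin r) ℝ) :
    stack (Function.update O i X) = stack O + singleBlock i (X - O i) := by
  ext ⟨j, a⟩ b
  rcases eq_or_ne j i with rfl | h
  · simp [stack, singleBlock]
  · simp [stack, singleBlock, h]

theorem singleBlock_add (i : Fin m) (X Y : Matrix (Fin (d i)) (Fin r) ℝ) :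
    singleBlock i (X + Y) = singleBlock i X + singleBlock i Y := by
  rw [singleBlock, Pi.single_add]
  rfl

theorem singleBlock_smul (i : Fin m) (c : ℝ) (X : Matrix (Fin (d i)) (Fin r) ℝ) :
    singleBlock i (c • X) = c • singleBlock i X := by
  rw [singleBlock, Pi.single_smul]
  rfl

end Blocks

/-! ### Optimality conditions for (OTSM). -/

section Optimality

variable {m r : ℕ} {d : Fin m → ℕ} {S : Matrix (Idx d) (Idx d) ℝ}
  {O : (i : Fin m) → Matrix (Fin (d i)) (Fin r) ℝ}

theorem isOTSMSolution_iff : IsOTSMSolution S O ↔ (∀ i, O i ∈ stiefel (d i) r) ∧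
    ∀ Q : (i : Fin m) → Matrix (Fin (d i)) (Fin r) ℝ, (∀ i, Q i ∈ stiefel (d i) r) →
      frobInner (stack Q) (S * stack Q) ≤ frobInner (stack O) (S * stack O) := by
  simp only [IsOTSMSolution, sum_trace_eq_frobInner]
  rfl

theorem mul_mem_stiefel {e f : ℕ} {Q : Matrix (Fin e) (Fin f) ℝ} {X : Matrix (Fin f) (Fin r) ℝ}
    (hQ : Q ∈ stiefel e f) (hX : X ∈ stiefel f r) : Q * X ∈ stiefel e r := by
  change (Q * X)ᵀ * (Q * X) = 1
  rw [Matrix.transpose_mul, Matrix.mul_assoc, ← Matrix.mul_assoc Qᵀ,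
    show Qᵀ * Q = 1 from hQ, Matrix.one_mul]
  exact hX

/-- Changing one block keeps feasibility, and the objective is quadratic, so its second-order
expansion at `O` is exact. -/
theorem IsOTSMSolution.update_le (hS : Sᵀ = S) (hO : IsOTSMSolution S O) (i : Fin m)
    {X : Matrix (Fin (d i)) (Fin r) ℝ} (hX : X ∈ stiefel (d i) r) :
    2 * frobInner (X - O i) (rowBlock (S * stack O) i) +
      frobInner (singleBlock i (X - O i)) (S * singleBlock i (X - O i)) ≤ 0 := by
  rw [isOTSMSolution_iff] at hO
  have h := hO.2 (Function.update O i X) fun j => by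
    rcases eq_or_ne j i with rfl | hj
    · simpa using hX
    · simpa [hj] using hO.1 j
  rw [stack_update, frobInner_add_mul_add hS, frobInner_singleBlock] at h
  linarith

/-- First-order optimality: `[S O]_i O_iᵀ` is symmetric. -/
theorem IsOTSMSolution.rowBlock_mul_transpose_symm (hS : Sᵀ = S) (hO : IsOTSMSolution S O)
    (i : Fin m) :
    (rowBlock (S * stack O) i * (O i)ᵀ)ᵀ = rowBlock (S * stack O) i * (O i)ᵀ := by
  apply isSymm_of_frobInner_planeGen
  intro a b hab
  rw [frobInner_mul_right', Matrix.transpose_transpose]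
  set E₁ := planeGen a b * O i with hE₁
  set E₂ := planeGen a b * planeGen a b * O i with hE₂
  set T₁ := singleBlock i E₁
  set T₂ := singleBlock i E₂
  have key : 2 * frobInner E₁ (rowBlock (S * stack O) i) = 0 := by
    apply eq_zero_of_trig_le (b := 2 * frobInner E₂ (rowBlock (S * stack O) i))
      (c := frobInner T₁ (S * T₁)) (d := frobInner T₁ (S * T₂) + frobInner T₂ (S * T₁))
      (e := frobInner T₂ (S * T₂))
    intro t
    have h := hO.update_le hS i (mul_mem_stiefel (planeRot_orthogonal hab t) (hO.1 i))
    have hX : planeRot a b t * O i - O i = Real.sin t • E₁ + (1 - Real.cos t) • E₂ := by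
      rw [planeRot, Matrix.add_mul, Matrix.add_mul, Matrix.one_mul, Matrix.smul_mul,
        Matrix.smul_mul]
      abel
    rw [hX, singleBlock_add, singleBlock_smul, singleBlock_smul] at h
    simp only [Matrix.mul_add, Matrix.mul_smul, frobInner_add_left, frobInner_add_right,
      frobInner_smul_left, frobInner_smul_right] at h
    refine le_trans (le_of_eq ?_) h
    ring
  linarith

/-- First-order optimality: `[S O]_i = O_i Λ_i` with the symmetric multiplier
`Λ_i = O_iᵀ [S O]_i`. -/
theorem IsOTSMSolution.multiplier (hS : Sᵀ = S) (hO : IsOTSMSolution S O) (i : Fin m) :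
    ((O i)ᵀ * rowBlock (S * stack O) i)ᵀ = (O i)ᵀ * rowBlock (S * stack O) i ∧
      O i * ((O i)ᵀ * rowBlock (S * stack O) i) = rowBlock (S * stack O) i := by
  have h := hO.rowBlock_mul_transpose_symm hS i
  have h1 : (O i)ᵀ * O i = 1 := hO.1 i
  generalize rowBlock (S * stack O) i = G at h ⊢
  rw [Matrix.transpose_mul, Matrix.transpose_transpose] at h
  have hG : O i * (Gᵀ * O i) = G := by
    rw [← Matrix.mul_assoc, h, Matrix.mul_assoc, h1, Matrix.mul_one]
  have hs : (O i)ᵀ * G = Gᵀ * O i := by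
    conv_lhs => rw [← hG, ← Matrix.mul_assoc, h1, Matrix.one_mul]
  rw [Matrix.transpose_mul, Matrix.transpose_transpose, hs]
  exact ⟨rfl, hG⟩

/-- A solution exists, and rotating it on the right makes `Θᵀ O` positive semidefinite. -/
theorem exists_isOTSMSolution_posSemidef (S : Matrix (Idx d) (Idx d) ℝ)
    (Θ : (i : Fin m) → Matrix (Fin (d i)) (Fin r) ℝ) (hΘ : ∀ i, Θ i ∈ stiefel (d i) r) :
    ∃ O : (i : Fin m) → Matrix (Fin (d i)) (Fin r) ℝ,
      IsOTSMSolution S O ∧ ((stack Θ)ᵀ * stack O).PosSemidef := by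
  have hcpt : IsCompact {Q : (i : Fin m) → Matrix (Fin (d i)) (Fin r) ℝ |
      ∀ i, Q i ∈ stiefel (d i) r} := by
    have := isCompact_univ_pi fun i => isCompact_stiefel (d i) r
    convert this using 1
    ext
    simp
  obtain ⟨O₀, hO₀, hmax⟩ := hcpt.exists_isMaxOn ⟨Θ, hΘ⟩
    (f := fun Q => ∑ i, ∑ j, ((Q i)ᵀ * block S i j * Q j).trace) (by fun_prop)
  have hsol : IsOTSMSolution S O₀ := ⟨hO₀, hmax⟩
  -- Maximizing `tr(Θᵀ O₀ Q)` over orthogonal `Q` plays the role of a polar decomposition: at the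
  -- optimum no further rotation helps, which forces positivity.
  obtain ⟨Q, hQ, hQmax⟩ := (isCompact_stiefel r r).exists_isMaxOn
    ⟨1, show (1 : Matrix (Fin r) (Fin r) ℝ)ᵀ * 1 = 1 by simp⟩
    (f := fun Q => ((stack Θ)ᵀ * stack O₀ * Q).trace) (by fun_prop)
  have hst : stack (fun i => O₀ i * Q) = stack O₀ * Q := rfl
  refine ⟨fun i => O₀ i * Q, ?_, ?_⟩
  · rw [isOTSMSolution_iff] at hsol ⊢
    refine ⟨fun i => mul_mem_stiefel (hsol.1 i) hQ, fun X hX => (hsol.2 X hX).trans_eq ?_⟩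
    symm
    rw [hst, ← Matrix.mul_assoc, frobInner_mul_right', Matrix.mul_assoc,
      stiefel_self_mul_transpose hQ, Matrix.mul_one]
  · rw [hst, ← Matrix.mul_assoc]
    refine posSemidef_of_trace_mul_le fun R hR => ?_
    rw [Matrix.mul_assoc]
    exact hQmax (mul_mem_stiefel hQ hR)

end Optimality

/-! ### Positive semidefinite matrices through the Frobenius pairing. -/

section PosSemidef

variable {p q : Type*} [Fintype p] [Fintype q]

open scoped MatrixOrder in
theorem exists_eq_transpose_mul_self {P : Matrix p p ℝ} (hP : P.PosSemidef) :
    ∃ B : Matrix p p ℝ, P = Bᵀ * B := by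
  classical
  obtain ⟨B, hB⟩ := CStarAlgebra.nonneg_iff_eq_star_mul_self.mp hP.nonneg
  exact ⟨B, by rw [hB, Matrix.star_eq_conjTranspose, Matrix.conjTranspose_eq_transpose_of_trivial]⟩

theorem transpose_eq_of_posSemidef {p : Type*} {P : Matrix p p ℝ} (hP : P.PosSemidef) : Pᵀ = P := by
  rw [← Matrix.conjTranspose_eq_transpose_of_trivial]
  exact hP.isHermitian

theorem frobInner_mul_nonneg {P : Matrix p p ℝ} (hP : P.PosSemidef) (X : Matrix p q ℝ) :
    0 ≤ frobInner X (P * X) := by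
  obtain ⟨B, rfl⟩ := exists_eq_transpose_mul_self hP
  rw [Matrix.mul_assoc, ← Matrix.transpose_transpose B, ← frobInner_mul_left,
    Matrix.transpose_transpose, frobInner_self]
  positivity

theorem posSemidef_of_frobInner {P : Matrix p p ℝ} (hP : Pᵀ = P)
    (h : ∀ X : Matrix p Unit ℝ, 0 ≤ frobInner X (P * X)) : P.PosSemidef := by
  refine Matrix.PosSemidef.of_dotProduct_mulVec_nonneg hP fun x => ?_
  have := h (Matrix.replicateCol Unit x)
  simpa [frobInner_eq_sum, Matrix.mul_apply, Matrix.mulVec, dotProduct] using this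

theorem trace_mul_nonneg {A B : Matrix p p ℝ} (hA : A.PosSemidef) (hB : B.PosSemidef) :
    0 ≤ (A * B).trace := by
  obtain ⟨G, rfl⟩ := exists_eq_transpose_mul_self hB
  have h := frobInner_mul_nonneg hA Gᵀ
  rwa [frobInner, Matrix.transpose_transpose, Matrix.trace_mul_comm, Matrix.mul_assoc] at h

end PosSemidef

/-! ### Global distance between a maximizer and the signal. -/

section Perturbation

theorem frobInner_signal_add_noise_mul {p q n : Type*} [Fintype p] [Fintype q] [Fintype n]
    (T : Matrix p n ℝ) (W : Matrix p p ℝ) (Y : Matrix p q ℝ) :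
    frobInner Y ((T * Tᵀ + W) * Y) = frobNorm (Tᵀ * Y) ^ 2 + frobInner Y (W * Y) := by
  rw [Matrix.add_mul, frobInner_add_right, Matrix.mul_assoc, frobInner_mul_right, frobInner_self]

variable {p q : Type*} [Fintype p] [Fintype q] {r : ℕ} {m : ℝ} {T V : Matrix p (Fin r) ℝ}

theorem frobNorm_gram_mul_le (hm : 0 ≤ m) (hT : Tᵀ * T = m • 1) (hV : Vᵀ * V = m • 1)
    (X : Matrix (Fin r) q ℝ) : frobNorm (Tᵀ * V * X) ≤ m * frobNorm X := by
  rw [Matrix.mul_assoc]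
  refine (frobNorm_transpose_mul_of_gram hm hT _).trans_eq ?_
  rw [frobNorm_mul_of_gram hm hV, ← mul_assoc, Real.mul_self_sqrt hm]

/-- Write `TᵀV = m I + Tᵀ(V - T)`; the error has size at most `√m ‖V - T‖`. -/
theorem le_frobInner_gram_mul (hm : 0 ≤ m) (hT : Tᵀ * T = m • 1) (X : Matrix (Fin r) q ℝ) :
    (m - √m * frobNorm (V - T)) * frobNorm X ^ 2 ≤ frobInner X (Tᵀ * V * X) := by
  have h1 : frobInner X (Tᵀ * V * X) =
      frobInner (T * X) (T * X) + frobInner (T * X) ((V - T) * X) := by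
    rw [← frobInner_add_right, ← Matrix.add_mul, add_sub_cancel, frobInner_mul_left,
      Matrix.mul_assoc]
  have h2 := neg_le_frobInner (T * X) ((V - T) * X)
  rw [frobInner_self, frobNorm_sq_of_gram hT] at h1
  have h3 := mul_le_mul_of_nonneg_left (frobNorm_mul_le (V - T) X) (frobNorm_nonneg (T * X))
  rw [frobNorm_mul_of_gram hm hT] at h2 h3
  nlinarith

variable [DecidableEq p] {W : Matrix p p ℝ}

/-- A matrix `V` with Gram matrix `m` whose objective value is at least that of the signal `T`,
and which is aligned with `T`, is close to `T`. -/
theorem frobNorm_sub_le (hm : 0 < m) (hT : Tᵀ * T = m • 1) (hV : Vᵀ * V = m • 1)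
    (hW : Wᵀ = W) (hP : (Tᵀ * V).PosSemidef)
    (h : frobInner T ((T * Tᵀ + W) * T) ≤ frobInner V ((T * Tᵀ + W) * V)) :
    frobNorm (V - T) ≤ 4 * opNorm W * √(r / m) := by
  have hTn : frobNorm T = √m * √r := by
    have := frobNorm_mul_of_gram hm.le hT (1 : Matrix (Fin r) (Fin r) ℝ)
    rw [Matrix.mul_one] at this
    rw [this, frobNorm_one]
  have hVn : frobNorm V = √m * √r := by
    have := frobNorm_mul_of_gram hm.le hV (1 : Matrix (Fin r) (Fin r) ℝ)
    rw [Matrix.mul_one] at this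
    rw [this, frobNorm_one]
  have hms := Real.mul_self_sqrt hm.le
  have hrs := Real.mul_self_sqrt (Nat.cast_nonneg (α := ℝ) r)
  rw [frobInner_signal_add_noise_mul, frobInner_signal_add_noise_mul, hT] at h
  have hTT : frobNorm ((m : ℝ) • (1 : Matrix (Fin r) (Fin r) ℝ)) ^ 2 = m ^ 2 * r := by
    rw [← frobInner_self, frobInner_smul_left, frobInner_smul_right, frobInner_self, frobNorm_one,
      Real.sq_sqrt (Nat.cast_nonneg _)]
    ring
  rw [hTT] at h
  -- the noise term
  have hnoise : frobInner V (W * V) - frobInner T (W * T) = frobInner (V - T) (W * (V + T)) := by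
    have : frobInner T (W * V) = frobInner V (W * T) := by
      rw [frobInner_mul_right, hW, frobInner_comm]
    rw [Matrix.mul_add, frobInner_sub_left, frobInner_add_right, frobInner_add_right, this]
    ring
  have hnoise' : frobInner (V - T) (W * (V + T)) ≤
      frobNorm (V - T) * (opNorm W * (2 * (√m * √r))) := by
    refine (frobInner_le _ _).trans ?_
    refine mul_le_mul_of_nonneg_left ?_ (frobNorm_nonneg _)
    refine (frobNorm_mul_le_opNorm _ _).trans ?_
    refine mul_le_mul_of_nonneg_left ?_ (opNorm_nonneg _)
    refine (frobNorm_add_le _ _).trans_eq ?_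
    rw [hTn, hVn]
    ring
  -- the signal term
  have hsig : frobNorm (Tᵀ * V) ^ 2 ≤ m * (Tᵀ * V).trace := by
    have hle := frobNorm_gram_mul_le (q := Fin r) hm.le hT hV
    obtain ⟨B, hB⟩ := exists_eq_transpose_mul_self hP
    have h1 : frobNorm (Tᵀ * V) ^ 2 = frobInner Bᵀ (Tᵀ * V * Bᵀ) := by
      rw [frobInner_mul_right', Matrix.transpose_transpose, ← hB, frobInner_self]
    have h2 : frobNorm Bᵀ ^ 2 = (Tᵀ * V).trace := by
      rw [frobNorm_transpose, ← frobInner_self, hB, frobInner]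
    rw [h1, ← h2, sq, mul_left_comm]
    exact (frobInner_le _ _).trans (mul_le_mul_of_nonneg_left (hle _) (frobNorm_nonneg _))
  have hdist : frobNorm (V - T) ^ 2 = 2 * (m * r) - 2 * (Tᵀ * V).trace := by
    rw [← frobInner_self, frobInner_sub_left, frobInner_sub_right, frobInner_sub_right,
      frobInner_comm V T, frobInner_self, frobInner_self, hTn, hVn, frobInner]
    linear_combination 2 * (√r * √r) * hms + 2 * m * hrs
  -- The loss of signal is at least `m (m r - tr P) = m ‖V - T‖² / 2`, and the gain from noise is at
  -- most `2 ‖W‖ √m √r ‖V - T‖`.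
  have hquad : m * frobNorm (V - T) ^ 2 ≤ 4 * opNorm W * (√m * √r) * frobNorm (V - T) := by
    nlinarith
  have hfin : √(r / m) * m = √m * √r := by
    rw [Real.sqrt_div (Nat.cast_nonneg r)]
    field_simp
    rw [Real.sq_sqrt hm.le]
  rw [← hfin] at hquad
  rcases (frobNorm_nonneg (V - T)).eq_or_lt with h0 | h0
  · rw [← h0]
    have := opNorm_nonneg W
    positivity
  · have : m * frobNorm (V - T) * frobNorm (V - T) ≤
        m * frobNorm (V - T) * (4 * opNorm W * √(r / m)) := by linarith
    exact le_of_mul_le_mul_left this (by positivity)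

end Perturbation

/-! ### Estimates for a single block. -/

section BlockEstimates

variable {p q : Type*} [Fintype p] [Fintype q] {r : ℕ}

/-- Because both Gram matrices are `1`, the symmetric part of `Θᵀ(Θ - O)` is half of `(Θ - O)ᵀ(Θ -
O)`: the apparently first-order gain is quadratic in the distance. -/
theorem two_mul_frobInner_sub {O Θ : Matrix p (Fin r) ℝ} (hO : Oᵀ * O = 1) (hΘ : Θᵀ * Θ = 1)
    {P : Matrix (Fin r) (Fin r) ℝ} (hP : Pᵀ = P) :
    2 * frobInner (Θ - O) (Θ * P) = frobInner (Θ - O)ᵀ (P * (Θ - O)ᵀ) := by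
  have h1 : frobInner (Θ - O) (Θ * P) = frobInner (Θᵀ * (Θ - O)) P := frobInner_mul_right _ _ _
  have h2 : frobInner (Θᵀ * (Θ - O)) P = frobInner ((Θ - O)ᵀ * Θ) P := by
    rw [← frobInner_transpose, hP, Matrix.transpose_mul, Matrix.transpose_transpose]
  have h3 : Θᵀ * (Θ - O) + (Θ - O)ᵀ * Θ = (Θ - O)ᵀ * (Θ - O) := by
    simp only [Matrix.transpose_sub, Matrix.mul_sub, Matrix.sub_mul, hO, hΘ]
    abel
  rw [frobInner_mul_right' P, Matrix.transpose_transpose, ← h3, frobInner_add_left, ← h2, ← h1]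
  ring

/-- Expand `Oᵀ(ΘP + N) = P + Oᵀ(Θ - O)P + OᵀN`; the last two terms cost `m e` and `a`. -/
theorem le_frobInner_multiplier {O Θ N : Matrix p (Fin r) ℝ} {P : Matrix (Fin r) (Fin r) ℝ}
    {X : Matrix (Fin r) q ℝ} {c m e a : ℝ} (hO : Oᵀ * O = 1)
    (hP : c * frobNorm X ^ 2 ≤ frobInner X (P * X)) (hPn : frobNorm (P * X) ≤ m * frobNorm X)
    (he : frobNorm (Θ - O) ≤ e) (ha : frobNorm N ≤ a) :
    (c - m * e - a) * frobNorm X ^ 2 ≤ frobInner X (Oᵀ * (Θ * P + N) * X) := by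
  have hO' : Oᵀ * O = (1 : ℝ) • 1 := by rw [hO, one_smul]
  have hOX : frobNorm (O * X) = frobNorm X := by
    rw [frobNorm_mul_of_gram zero_le_one hO', Real.sqrt_one, one_mul]
  have h1 : frobInner X (Oᵀ * (Θ * P + N) * X) = frobInner X (P * X) +
      frobInner (O * X) ((Θ - O) * (P * X)) + frobInner (O * X) (N * X) := by
    have : frobInner X (P * X) = frobInner (O * X) (O * (P * X)) := by
      rw [frobInner_mul_left, ← Matrix.mul_assoc, hO, Matrix.one_mul]
    rw [this, ← frobInner_add_right, ← Matrix.add_mul, add_sub_cancel, ← frobInner_add_right,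
      frobInner_mul_left, ← Matrix.mul_assoc Θ, ← Matrix.add_mul, Matrix.mul_assoc]
  have h2 := neg_le_frobInner (O * X) ((Θ - O) * (P * X))
  have h3 := neg_le_frobInner (O * X) (N * X)
  have h4 : frobNorm ((Θ - O) * (P * X)) ≤ e * (m * frobNorm X) :=
    (frobNorm_mul_le _ _).trans
      (mul_le_mul he hPn (frobNorm_nonneg _) ((frobNorm_nonneg _).trans he))
  have h5 : frobNorm (N * X) ≤ a * frobNorm X :=
    (frobNorm_mul_le _ _).trans (mul_le_mul_of_nonneg_right ha (frobNorm_nonneg _))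
  have hX := frobNorm_nonneg X
  rw [hOX] at h2 h3
  nlinarith

end BlockEstimates

/-! ### Feasibility of `O Oᵀ` and the dual certificate. -/

section Certificate

variable {m r : ℕ} {d : Fin m → ℕ}

theorem trace_eq_sum_block (U : Matrix (Idx d) (Idx d) ℝ) :
    U.trace = ∑ i, (block U i i).trace := by
  simp only [Matrix.trace, Fintype.sum_sigma]
  rfl

theorem block_mul_transpose (Y Z : Matrix (Idx d) (Fin r) ℝ) (i j : Fin m) :
    block (Y * Zᵀ) i j = rowBlock Y i * (rowBlock Z j)ᵀ := rfl

theorem rowBlock_blockDiagonal'_mul (M : (i : Fin m) → Matrix (Fin (d i)) (Fin (d i)) ℝ)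
    (Y : Matrix (Idx d) (Fin r) ℝ) (i : Fin m) :
    rowBlock (Matrix.blockDiagonal' M * Y) i = M i * rowBlock Y i := by
  ext a b
  simp only [rowBlock, Matrix.of_apply, Matrix.mul_apply, Fintype.sum_sigma]
  rw [Finset.sum_eq_single i]
  · simp
  · intro j _ hj
    simp [Matrix.blockDiagonal'_apply_ne _ _ _ hj.symm]
  · simp

theorem trace_blockDiagonal'_mul (M : (i : Fin m) → Matrix (Fin (d i)) (Fin (d i)) ℝ)
    (U : Matrix (Idx d) (Idx d) ℝ) :
    (Matrix.blockDiagonal' M * U).trace = ∑ i, (M i * block U i i).trace := by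
  simp only [Matrix.trace, Matrix.diag_apply, Matrix.mul_apply, Fintype.sum_sigma]
  refine Finset.sum_congr rfl fun i _ => Finset.sum_congr rfl fun a _ => ?_
  rw [Finset.sum_eq_single i]
  · simp [block]
  · intro j _ hj
    simp [Matrix.blockDiagonal'_apply_ne _ _ _ hj.symm]
  · simp

theorem posSemidef_blockDiagonal' {M : (i : Fin m) → Matrix (Fin (d i)) (Fin (d i)) ℝ}
    (hM : ∀ i, (M i).PosSemidef) : (Matrix.blockDiagonal' M).PosSemidef := by
  choose B hB using fun i => exists_eq_transpose_mul_self (hM i)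
  have : Matrix.blockDiagonal' M = (Matrix.blockDiagonal' B)ᴴ * Matrix.blockDiagonal' B := by
    rw [Matrix.blockDiagonal'_conjTranspose, ← Matrix.blockDiagonal'_mul]
    congr 1
    funext i
    rw [hB i, Matrix.conjTranspose_eq_transpose_of_trivial]
  rw [this]
  exact Matrix.posSemidef_conjTranspose_mul_self _

theorem posSemidef_mul_mul_transpose {p q : Type*} [Fintype p] [Fintype q] {N : Matrix q q ℝ}
    (hN : N.PosSemidef) (O : Matrix p q ℝ) : (O * N * Oᵀ).PosSemidef := by
  rw [← Matrix.conjTranspose_eq_transpose_of_trivial]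
  exact hN.mul_mul_conjTranspose_same O

/-- The Gram matrix of stacked semi-orthogonal blocks is feasible for the relaxation. -/
theorem stack_mul_transpose_mem_sdpFeasible {O : (i : Fin m) → Matrix (Fin (d i)) (Fin r) ℝ}
    (hO : ∀ i, O i ∈ stiefel (d i) r) : stack O * (stack O)ᵀ ∈ sdpFeasible d r := by
  have hpsd := posSemidef_mul_mul_transpose Matrix.PosSemidef.one (stack O)
  rw [Matrix.mul_one] at hpsd
  refine ⟨transpose_eq_of_posSemidef hpsd, hpsd, fun i => ?_⟩
  have h1 : (O i)ᵀ * O i = 1 := hO i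
  rw [block_mul_transpose, rowBlock_stack]
  constructor
  -- `1 - O_i O_iᵀ` is a symmetric idempotent, hence a Gram matrix.
  · have hidem : 1 - O i * (O i)ᵀ = (1 - O i * (O i)ᵀ) * 1 * (1 - O i * (O i)ᵀ)ᵀ := by
      have h2 : O i * (O i)ᵀ * (O i * (O i)ᵀ) = O i * (O i)ᵀ := by
        rw [Matrix.mul_assoc, ← Matrix.mul_assoc (O i)ᵀ, h1, Matrix.one_mul]
      simp [Matrix.sub_mul, Matrix.mul_sub, h2]
    rw [hidem]
    exact posSemidef_mul_mul_transpose Matrix.PosSemidef.one _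
  · rw [Matrix.trace_mul_comm, h1]
    simp

theorem rank_stack_mul_transpose (hm : 0 < m) {O : (i : Fin m) → Matrix (Fin (d i)) (Fin r) ℝ}
    (hO : ∀ i, O i ∈ stiefel (d i) r) : (stack O * (stack O)ᵀ).rank = r := by
  rw [Matrix.rank_self_mul_transpose, ← Matrix.rank_transpose_mul_self, gram_stack hO,
    Matrix.rank_of_isUnit, Fintype.card_fin]
  simp [Matrix.isUnit_iff_isUnit_det, hm.ne']

variable {S U : Matrix (Idx d) (Idx d) ℝ} {O : (i : Fin m) → Matrix (Fin (d i)) (Fin r) ℝ}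

theorem posSemidef_one_sub_compress (hU : U ∈ sdpFeasible d r)
    (hO : ∀ i, O i ∈ stiefel (d i) r) (i : Fin m) :
    (1 - (O i)ᵀ * block U i i * O i).PosSemidef := by
  have := posSemidef_mul_mul_transpose (hU.2.2 i).1 (O i)ᵀ
  rwa [Matrix.mul_sub, Matrix.mul_one, Matrix.sub_mul, Matrix.transpose_transpose,
    show (O i)ᵀ * O i = 1 from hO i] at this

/-- A feasible point of the relaxation whose range lies in that of `O` is `O Oᵀ`. -/
theorem eq_stack_mul_transpose_of_range (hm : 0 < m) (hU : U ∈ sdpFeasible d r)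
    (hO : ∀ i, O i ∈ stiefel (d i) r) {N : Matrix (Fin r) (Fin r) ℝ}
    (hN : U = stack O * N * (stack O)ᵀ) : U = stack O * (stack O)ᵀ := by
  have i : Fin m := ⟨0, hm⟩
  have h1 : (O i)ᵀ * O i = 1 := hO i
  have hb : block U i i = O i * N * (O i)ᵀ := by
    rw [hN, block_mul_transpose, rowBlock_mul, rowBlock_stack]
  have hc : (O i)ᵀ * block U i i * O i = N := by
    rw [hb, Matrix.mul_assoc, Matrix.mul_assoc, h1, Matrix.mul_one, ← Matrix.mul_assoc, h1,
      Matrix.one_mul]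
  have hpsd := posSemidef_one_sub_compress hU hO i
  rw [hc] at hpsd
  have htr : N.trace = r := by
    rw [← (hU.2.2 i).2, hb, Matrix.trace_mul_comm, ← Matrix.mul_assoc, h1, Matrix.one_mul]
  -- `1 - N` is positive semidefinite with trace `r - r = 0`, so one block already determines `N =
  -- 1`.
  have hzero := hpsd.trace_eq_zero_iff.mp (by simp [htr])
  rw [hN, ← sub_eq_zero.mp hzero, Matrix.mul_one]

/-- The dual certificate: if the multipliers `Λ_i` of a critical point `O` dominate `z`, and
the quadratic form of `S` is at most `z - κ` on the orthogonal complement of the range of `O`,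
then the relaxation is solved by `O Oᵀ` only. -/
theorem trace_mul_le_and_eq (hm : 0 < m) (hS : Sᵀ = S) (hO : ∀ i, O i ∈ stiefel (d i) r)
    {Λ : Fin m → Matrix (Fin r) (Fin r) ℝ} (hΛ : ∀ i, rowBlock (S * stack O) i = O i * Λ i)
    {z κ : ℝ} (hz : ∀ i, (Λ i - z • 1).PosSemidef) (hκ : 0 < κ)
    (hR : ∀ R : Matrix (Idx d) (Idx d) ℝ, (stack O)ᵀ * R = 0 →
      frobInner R (S * R) ≤ (z - κ) * frobNorm R ^ 2) (hU : U ∈ sdpFeasible d r) :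
    (S * U).trace ≤ frobInner (stack O) (S * stack O) ∧
      ((S * U).trace = frobInner (stack O) (S * stack O) → U = stack O * (stack O)ᵀ) := by
  obtain ⟨B, hB⟩ := exists_eq_transpose_mul_self hU.2.1
  set V := stack O with hV
  set C := Bᵀ with hC
  -- `V M` is the orthogonal projection of `C` onto the range of `V`, as `VᵀV = m I`; `R` is the
  -- remainder.
  set M : Matrix (Fin r) (Idx d) ℝ := (m : ℝ)⁻¹ • (Vᵀ * C) with hM
  set R := C - V * M with hRdef
  have hm' : (m : ℝ) ≠ 0 := by positivity
  have hVR : Vᵀ * R = 0 := by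
    rw [hRdef, Matrix.mul_sub, ← Matrix.mul_assoc, gram_stack hO, hM, Matrix.smul_mul,
      Matrix.one_mul, smul_smul, mul_inv_cancel₀ hm', one_smul, sub_self]
  have hCR : C = R + V * M := by rw [hRdef, sub_add_cancel]
  have hUC : U = C * Cᵀ := by rw [hB, hC, Matrix.transpose_transpose]
  have htrace : ∀ X : Matrix (Idx d) (Idx d) ℝ, (X * U).trace = frobInner C (X * C) := fun X => by
    rw [hUC, ← Matrix.mul_assoc, Matrix.trace_mul_comm, frobInner]
  -- `z` is the multiplier of the trace constraints, the blocks of `Z` those of `U_ii ≼ I`, and `L`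
  -- is the slack matrix.
  set Z := Matrix.blockDiagonal' fun i => O i * (Λ i - z • 1) * (O i)ᵀ with hZ
  have hZpsd : Z.PosSemidef := posSemidef_blockDiagonal' fun i =>
    posSemidef_mul_mul_transpose (hz i) (O i)
  set L := z • 1 + Z - S with hL
  have hLV : L * V = 0 := by
    have hblk : ∀ i, rowBlock (L * V) i = 0 := fun i => by
      have h1 : (O i)ᵀ * O i = 1 := hO i
      have : L * V = z • V + Z * V - S * V := by
        rw [hL, Matrix.sub_mul, Matrix.add_mul, Matrix.smul_mul, Matrix.one_mul]
      rw [this, rowBlock_sub, rowBlock_add, rowBlock_blockDiagonal'_mul, hV, hΛ, rowBlock_stack,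
        Matrix.mul_assoc, h1, Matrix.mul_one, Matrix.mul_sub, Matrix.mul_smul, Matrix.mul_one,
        show rowBlock (z • stack O) i = z • O i from rfl]
      abel
    ext ⟨i, a⟩ b
    exact congrFun (congrFun (hblk i) a) b
  have hLT : Lᵀ = L := by
    rw [hL]
    simp [hS, transpose_eq_of_posSemidef hZpsd]
  have hLC : frobInner C (L * C) = frobInner R (L * R) := by
    have h0 : L * C = L * R := by
      rw [hCR, Matrix.mul_add, ← Matrix.mul_assoc, hLV, Matrix.zero_mul, add_zero]
    rw [h0, frobInner_mul_right, hLT, h0, frobInner_mul_left, hLT]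
  have hLform : ∀ X : Matrix (Idx d) (Idx d) ℝ, frobInner X (L * X) =
      z * frobNorm X ^ 2 + frobInner X (Z * X) - frobInner X (S * X) := fun X => by
    rw [hL, Matrix.sub_mul, Matrix.add_mul, Matrix.smul_mul, Matrix.one_mul, frobInner_sub_right,
      frobInner_add_right, frobInner_smul_right, frobInner_self]
  have hLR : κ * frobNorm R ^ 2 ≤ frobInner R (L * R) := by
    have h1 := hLform R
    have h2 := frobInner_mul_nonneg hZpsd R
    have h3 := hR R hVR
    linarith
  have hCnorm : frobNorm C ^ 2 = m * r := by
    have h1 := htrace 1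
    rw [Matrix.one_mul, Matrix.one_mul, frobInner_self, trace_eq_sum_block] at h1
    rw [← h1, Finset.sum_congr rfl fun i _ => (hU.2.2 i).2]
    simp
  -- Pair `Λ_i - z ≽ 0` with `1 - O_iᵀ U_ii O_i ≽ 0`.
  have hZU : frobInner C (Z * C) ≤ ∑ i, ((Λ i).trace - z * r) := by
    rw [← htrace, hZ, trace_blockDiagonal'_mul]
    refine Finset.sum_le_sum fun i _ => ?_
    have h1 := trace_mul_nonneg (hz i) (posSemidef_one_sub_compress hU hO i)
    rw [Matrix.mul_sub, Matrix.mul_one, Matrix.trace_sub, Matrix.trace_sub, Matrix.trace_smul,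
      Matrix.trace_one, smul_eq_mul, Fintype.card_fin] at h1
    have h2 : (O i * (Λ i - z • 1) * (O i)ᵀ * block U i i).trace =
        ((Λ i - z • 1) * ((O i)ᵀ * block U i i * O i)).trace := by
      rw [Matrix.mul_assoc, Matrix.mul_assoc, Matrix.trace_mul_comm]
      simp only [Matrix.mul_assoc]
    rw [h2]
    linarith
  have hobj : frobInner V (S * V) = ∑ i, (Λ i).trace := by
    rw [frobInner_eq_sum_rowBlock]
    refine Finset.sum_congr rfl fun i _ => ?_
    rw [hV, hΛ, rowBlock_stack, frobInner, ← Matrix.mul_assoc,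
      show (O i)ᵀ * O i = 1 from hO i, Matrix.one_mul]
  have hmain : (S * U).trace ≤ frobInner V (S * V) - κ * frobNorm R ^ 2 := by
    have h1 := hLform C
    rw [hLC, ← htrace S, hCnorm] at h1
    rw [Finset.sum_sub_distrib] at hZU
    simp only [Finset.sum_const, Finset.card_univ, Fintype.card_fin, nsmul_eq_mul] at hZU
    rw [hobj]
    linarith
  refine ⟨hmain.trans (sub_le_self _ (by positivity)), fun heq => ?_⟩
  have hR0 : R = 0 := by
    apply frobNorm_eq_zero
    have h1 : κ * frobNorm R ^ 2 ≤ 0 := by linarith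
    have h2 : frobNorm R ^ 2 ≤ 0 := nonpos_of_mul_nonpos_right h1 hκ
    exact pow_eq_zero_iff two_ne_zero |>.mp (le_antisymm h2 (sq_nonneg _))
  refine eq_stack_mul_transpose_of_range hm hU hO (N := M * Mᵀ) ?_
  rw [hUC, hCR, hR0, zero_add, Matrix.transpose_mul, ← hV]
  simp only [Matrix.mul_assoc]

end Certificate

/-! ### The noise conditions produce the spectral gap. -/

section Tightness

variable {m r : ℕ} {d : Fin m → ℕ} {Θ O : (i : Fin m) → Matrix (Fin (d i)) (Fin r) ℝ}
  {W S : Matrix (Idx d) (Idx d) ℝ}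

theorem IsMAXBET.transpose_noise (h : IsMAXBET Θ W S) : Wᵀ = W := by
  ext ⟨i, a⟩ ⟨j, b⟩
  exact (congrFun (congrFun (h.noise_symm i j) a) b).symm

theorem IsMAXBET.eq_add (h : IsMAXBET Θ W S) : S = stack Θ * (stack Θ)ᵀ + W := by
  ext ⟨i, a⟩ ⟨j, b⟩
  exact congrFun (congrFun (h.model i j) a) b

theorem IsMAXBET.transpose_eq (h : IsMAXBET Θ W S) : Sᵀ = S := by
  rw [h.eq_add, Matrix.transpose_add, Matrix.transpose_mul, Matrix.transpose_transpose,
    h.transpose_noise]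

theorem neg_opNorm_le_frobInner {p q : Type*} [Fintype p] [Fintype q] [DecidableEq p]
    (W : Matrix p p ℝ) (Y : Matrix p q ℝ) :
    -(opNorm W * frobNorm Y ^ 2) ≤ frobInner Y (W * Y) := by
  have h1 := neg_le_frobInner Y (W * Y)
  have h2 := mul_le_mul_of_nonneg_left (frobNorm_mul_le_opNorm W Y) (frobNorm_nonneg Y)
  linarith

theorem frobInner_le_opNorm {p q : Type*} [Fintype p] [Fintype q] [DecidableEq p]
    (W : Matrix p p ℝ) (Y : Matrix p q ℝ) :
    frobInner Y (W * Y) ≤ opNorm W * frobNorm Y ^ 2 := by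
  have h1 := frobInner_le Y (W * Y)
  have h2 := mul_le_mul_of_nonneg_left (frobNorm_mul_le_opNorm W Y) (frobNorm_nonneg Y)
  linarith

/-- Split `W O = W Θ + W (O - Θ)`: the two pieces are the two summands of `noiseLevel`. -/
theorem frobNorm_rowBlock_noise_le
    (h : frobNorm (stack O - stack Θ) ≤ 4 * opNorm W * √((r : ℝ) / m)) (i : Fin m) :
    frobNorm (rowBlock (W * stack O) i) ≤ noiseLevel Θ W := by
  have hsplit : rowBlock (W * stack O) i =
      rowBlock (W * stack Θ) i + rowBlock (W * (stack O - stack Θ)) i := by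
    rw [← rowBlock_add, ← Matrix.mul_add, add_sub_cancel]
  rw [hsplit, noiseLevel]
  refine (frobNorm_add_le _ _).trans (add_le_add ?_ ?_)
  · exact le_ciSup (f := fun i => frobNorm (rowBlock (W * stack Θ) i))
      (Set.finite_range _).bddAbove i
  · refine (frobNorm_rowBlock_le _ _).trans ((frobNorm_mul_le_opNorm _ _).trans ?_)
    have := mul_le_mul_of_nonneg_left h (opNorm_nonneg W)
    linarith

theorem noiseLevel_nonneg : 0 ≤ noiseLevel Θ W :=
  add_nonneg (Real.iSup_nonneg fun _ => frobNorm_nonneg _) (by positivity)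

theorem IsMAXBET.rowBlock_mul (h : IsMAXBET Θ W S) (i : Fin m) :
    rowBlock (S * stack O) i =
      Θ i * ((stack Θ)ᵀ * stack O) + rowBlock (W * stack O) i := by
  rw [h.eq_add, Matrix.add_mul, Matrix.mul_assoc, rowBlock_add, OTSM.rowBlock_mul, rowBlock_stack]

/-- Each block of an aligned solution is close to the corresponding block of the signal. -/
theorem IsMAXBET.mul_frobNorm_sub_le (h : IsMAXBET Θ W S) (hO : IsOTSMSolution S O)
    (hP : ((stack Θ)ᵀ * stack O).PosSemidef) {c a : ℝ} (i : Fin m)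
    (hc : ∀ X : Matrix (Fin r) (Fin (d i)) ℝ,
      c * frobNorm X ^ 2 ≤ frobInner X ((stack Θ)ᵀ * stack O * X))
    (ha : frobNorm (rowBlock (W * stack O) i) ≤ a) :
    (c - opNorm W) * frobNorm (Θ i - O i) ≤ 2 * a := by
  have hle := hO.update_le h.transpose_eq i (h.semiorth i)
  rw [h.rowBlock_mul, frobInner_add_right, mul_add,
    two_mul_frobInner_sub (hO.1 i) (h.semiorth i) (transpose_eq_of_posSemidef hP), h.eq_add,
    frobInner_signal_add_noise_mul] at hle
  have h1 := hc (Θ i - O i)ᵀ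
  rw [frobNorm_transpose] at h1
  have h2 := neg_opNorm_le_frobInner W (singleBlock i (Θ i - O i))
  rw [frobNorm_singleBlock] at h2
  have h3 := neg_le_frobInner (Θ i - O i) (rowBlock (W * stack O) i)
  have h4 := mul_le_mul_of_nonneg_left ha (frobNorm_nonneg (Θ i - O i))
  -- The second-order signal term is nonnegative and can be dropped.
  have h5 := sq_nonneg (frobNorm ((stack Θ)ᵀ * singleBlock i (Θ i - O i)))
  have hquad : frobNorm (Θ i - O i) * ((c - opNorm W) * frobNorm (Θ i - O i)) ≤
      frobNorm (Θ i - O i) * (2 * a) := by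
    nlinarith
  rcases (frobNorm_nonneg (Θ i - O i)).eq_or_lt with h0 | h0
  · rw [← h0, mul_zero]
    linarith [(frobNorm_nonneg _).trans ha]
  · exact le_of_mul_le_mul_left hquad h0

/-- Orthogonality turns `ΘᵀR` into `-(O - Θ)ᵀR`, so the signal form is quadratic in `O - Θ`. -/
theorem IsMAXBET.frobInner_le_of_orthogonal {q : Type*} [Fintype q] (h : IsMAXBET Θ W S)
    {R : Matrix (Idx d) q ℝ} (hR : (stack O)ᵀ * R = 0) :
    frobInner R (S * R) ≤ (frobNorm (stack O - stack Θ) ^ 2 + opNorm W) * frobNorm R ^ 2 := by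
  rw [h.eq_add, frobInner_signal_add_noise_mul, add_mul, ← mul_pow]
  refine add_le_add ?_ (frobInner_le_opNorm W R)
  have : (stack Θ)ᵀ * R = -((stack O - stack Θ)ᵀ * R) := by
    rw [Matrix.transpose_sub, Matrix.sub_mul, hR, zero_sub, neg_neg]
  rw [this, frobNorm_neg]
  refine pow_le_pow_left₀ (frobNorm_nonneg _) ?_ 2
  rw [← frobNorm_transpose (stack O - stack Θ)]
  exact frobNorm_mul_le _ _

/-- In the small-noise regime, some solution `O` of the orthogonal trace-sum problem comes with a
certificate that `O Oᵀ` is the unique solution of the relaxation. -/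
theorem IsMAXBET.exists_certificate (hmodel : IsMAXBET Θ W S)
    (hm : opNorm W * (4 * √(r : ℝ) + 1) + 1 < (m : ℝ))
    (hsmall :
      4 * (m : ℝ) * (2 * noiseLevel Θ W /
            ((m : ℝ) - opNorm W * (4 * √(r : ℝ) + 1) - 1)) +
          2 * noiseLevel Θ W +
          8 * opNorm W * √((r : ℝ) / (m : ℝ)) + 2 * opNorm W < (m : ℝ)) :
    ∃ O : (i : Fin m) → Matrix (Fin (d i)) (Fin r) ℝ, IsOTSMSolution S O ∧
      ∀ U ∈ sdpFeasible d r, (S * U).trace ≤ frobInner (stack O) (S * stack O) ∧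
      ((S * U).trace = frobInner (stack O) (S * stack O) → U = stack O * (stack O)ᵀ) := by
  have hW0 := opNorm_nonneg W
  have hA0 : 0 ≤ noiseLevel Θ W := noiseLevel_nonneg
  have hmpos : (0 : ℝ) < m := by nlinarith [Real.sqrt_nonneg (r : ℝ)]
  have hmpos' : 0 < m := by exact_mod_cast hmpos
  obtain ⟨O, hO, hP⟩ := exists_isOTSMSolution_posSemidef S Θ hmodel.semiorth
  have hO' := isOTSMSolution_iff.mp hO
  have hT := gram_stack hmodel.semiorth
  have hV := gram_stack hO.1
  refine ⟨O, hO, fun U hU => ?_⟩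
  have hdist : frobNorm (stack O - stack Θ) ≤ 4 * opNorm W * √((r : ℝ) / m) := by
    refine frobNorm_sub_le hmpos hT hV hmodel.transpose_noise hP ?_
    rw [← hmodel.eq_add]
    exact hO'.2 Θ hmodel.semiorth
  have hsqrt : √(m : ℝ) * (4 * opNorm W * √((r : ℝ) / m)) = 4 * opNorm W * √(r : ℝ) := by
    rw [Real.sqrt_div (Nat.cast_nonneg r)]
    field_simp
  have hsqrt_dist := mul_le_mul_of_nonneg_left hdist (Real.sqrt_nonneg (m : ℝ))
  rw [hsqrt] at hsqrt_dist
  set A := noiseLevel Θ W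
  set w := opNorm W
  set e := 2 * A / ((m : ℝ) - w * (4 * √(r : ℝ) + 1) - 1) with he
  have hden : 0 < (m : ℝ) - w * (4 * √(r : ℝ) + 1) - 1 := by linarith
  have he0 : 0 ≤ e := by positivity
  have hblock : ∀ i, frobNorm (Θ i - O i) ≤ e := fun i => by
    rw [he, le_div_iff₀ hden]
    have := hmodel.mul_frobNorm_sub_le hO hP (c := m - 4 * w * √(r : ℝ)) (a := A) i
      (fun X => le_trans (mul_le_mul_of_nonneg_right (by linarith) (sq_nonneg _))
        (le_frobInner_gram_mul hmpos.le hT X))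
      (frobNorm_rowBlock_noise_le hdist i)
    -- The blockwise estimate has the factor `m - w(4√r + 1)`; the extra `-1` in the denominator of
    -- `e` only weakens it.
    nlinarith [frobNorm_nonneg (Θ i - O i)]
  have hdist_sq : frobNorm (stack O - stack Θ) ^ 2 ≤ m * e ^ 2 := by
    rw [frobNorm_sq_eq_sum_rowBlock]
    refine (Finset.sum_le_card_nsmul _ _ (e ^ 2) fun i _ => ?_).trans_eq (by simp)
    rw [rowBlock_sub, rowBlock_stack, rowBlock_stack, ← frobNorm_neg, neg_sub]
    exact pow_le_pow_left₀ (frobNorm_nonneg _) (hblock i) 2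
  -- Summing the block bounds yields a second global bound, which replaces the coercivity constant
  -- `m - 4w√r` of `ΘᵀO` by `m - m e`.
  have hdist_e : √(m : ℝ) * frobNorm (stack O - stack Θ) ≤ m * e := by
    have h1 : frobNorm (stack O - stack Θ) ≤ √(m : ℝ) * e := by
      refine le_of_sq_le_sq ?_ (by positivity)
      rwa [mul_pow, Real.sq_sqrt hmpos.le]
    refine (mul_le_mul_of_nonneg_left h1 (Real.sqrt_nonneg _)).trans_eq ?_
    rw [← mul_assoc, Real.mul_self_sqrt hmpos.le]
  -- One `m e` is lost in the coercivity of `ΘᵀO`, the other in replacing `Θ_i` by `O_i`; `A` pays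
  -- for the noise.
  set z : ℝ := m - m * e - m * e - A with hz
  set κ : ℝ := z - (m * e ^ 2 + w) with hκ
  have hκpos : 0 < κ := by
    -- Half of the smallness condition gives `2 m e + A + w < m / 2`; it also gives `e ≤ 1/4`, so `m
    -- e² ≤ m / 4`.
    have h1 : 0 ≤ 8 * w * √((r : ℝ) / m) := by positivity
    have h2 : m * e ≤ m * (1 / 4) := by linarith
    have h3 : e ≤ 1 / 4 := le_of_mul_le_mul_left h2 hmpos
    have h4 : m * e ^ 2 ≤ m * (1 / 4) := by
      refine mul_le_mul_of_nonneg_left ?_ hmpos.le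
      nlinarith
    linarith
  have hstat := fun i => hO.multiplier hmodel.transpose_eq i
  refine trace_mul_le_and_eq hmpos' hmodel.transpose_eq hO.1
    (Λ := fun i => (O i)ᵀ * rowBlock (S * stack O) i) (z := z) (κ := κ)
    (fun i => (hstat i).2.symm) (fun i => ?_) hκpos (fun R hR => ?_) hU
  · refine posSemidef_of_frobInner ?_ fun X => ?_
    · rw [Matrix.transpose_sub, (hstat i).1]
      simp
    · have h1 := le_frobInner_multiplier (hO.1 i) (c := m - m * e)
        (le_trans (mul_le_mul_of_nonneg_right (by linarith) (sq_nonneg _))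
          (le_frobInner_gram_mul hmpos.le hT X))
        (frobNorm_gram_mul_le hmpos.le hT hV X) (hblock i) (frobNorm_rowBlock_noise_le hdist i)
      rw [← hmodel.rowBlock_mul] at h1
      rw [Matrix.sub_mul, Matrix.smul_mul, Matrix.one_mul, frobInner_sub_right,
        frobInner_smul_right, frobInner_self]
      linarith
  · refine (hmodel.frobInner_le_of_orthogonal hR).trans
      (mul_le_mul_of_nonneg_right ?_ (sq_nonneg _))
    linarith

end Tightness

end OTSM

theorem theorem3p1 (m r : ℕ) (d : Fin m → ℕ)
    (Θ : (i : Fin m) → Matrix (Fin (d i)) (Fin r) ℝ)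
    (W S : Matrix (OTSM.Idx d) (OTSM.Idx d) ℝ)
    (hmodel : OTSM.IsMAXBET Θ W S)
    (hm : OTSM.opNorm W * (4 * √(r : ℝ) + 1) + 1 < (m : ℝ))
    (hsmall :
      4 * (m : ℝ) * (2 * OTSM.noiseLevel Θ W /
            ((m : ℝ) - OTSM.opNorm W * (4 * √(r : ℝ) + 1) - 1)) +
          2 * OTSM.noiseLevel Θ W +
          8 * OTSM.opNorm W * √((r : ℝ) / (m : ℝ)) + 2 * OTSM.opNorm W < (m : ℝ)) :
    (∃ U : Matrix (OTSM.Idx d) (OTSM.Idx d) ℝ, OTSM.IsSDPSolution r S U) ∧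
    ∀ U : Matrix (OTSM.Idx d) (OTSM.Idx d) ℝ, OTSM.IsSDPSolution r S U →
      OTSM.IsRankSolution r S U ∧
        ∃ O : (i : Fin m) → Matrix (Fin (d i)) (Fin r) ℝ,
          OTSM.IsOTSMSolution S O ∧ U = OTSM.stack O * (OTSM.stack O).transpose := by
  have hmpos : 0 < m := by
    have : (0 : ℝ) < m := by nlinarith [Real.sqrt_nonneg (r : ℝ), OTSM.opNorm_nonneg W]
    exact_mod_cast this
  obtain ⟨O, hO, hcert⟩ := hmodel.exists_certificate hm hsmall
  have hfeas := OTSM.stack_mul_transpose_mem_sdpFeasible hO.1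
  have hval : (S * (OTSM.stack O * (OTSM.stack O).transpose)).trace =
      OTSM.frobInner (OTSM.stack O) (S * OTSM.stack O) := by
    rw [← Matrix.mul_assoc, Matrix.trace_mul_comm, OTSM.frobInner]
  refine ⟨⟨_, hfeas, fun U hU => ((hcert U hU).1.trans_eq hval.symm)⟩, fun U hU => ?_⟩
  have hUeq : U = OTSM.stack O * (OTSM.stack O).transpose :=
    (hcert U hU.1).2 (le_antisymm (hcert U hU.1).1 (hval ▸ hU.2 hfeas))
  -- Optimality passes to the smaller rank-`r` set, so only the rank of `O Oᵀ` remains.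
  refine ⟨⟨⟨hU.1, ?_⟩, fun X hX => hU.2 hX.1⟩, O, hO, hUeq⟩
  rw [hUeq]
  exact OTSM.rank_stack_mul_transpose hmpos hO.1
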